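/- Let $M^n$ be a smooth Riemannian manifold with Levi-Civita connection $\nabla$, let $f\colon M^n\to\mathbb{R}^m$ be a smooth isometric immersion with normal bundle $N_fM$, normal connection $\nabla^\perp$ and second fundamental form $\alpha\colon TM\times TM\to N_fM$, let $\tilde\nabla$ be the flat connection of $\mathbb{R}^m$, and denote by $(\cdot)_{N_fM}$ the orthogonal projection onto the normal bundle. Let $\mathcal T$ be an infinitesimal bending of $f$, that is, a smooth section of $f^*T\mathbb{R}^m$ with $\langle\tilde\nabla_X\mathcal T,f_*Y\rangle+\langle f_*X,\tilde\nabla_Y\mathcal T\rangle=0$ for all $X,Y\in\mathfrak X(M)$. Put $LX=\tilde\nabla_X\mathcal T$ and $$\beta(X,Y)=\big(\tilde\nabla_XLY-L\nabla_XY\big)_{N_fM}.$$ For $\xi\in\Gamma(N_fM)$ define $A_\xi,B_\xi\in\Gamma(\mathrm{End}(TM))$ by $\langle A_\xi X,Y\rangle=\langle\alpha(X,Y),\xi\rangle$ and $\langle B_\xi X,Y\rangle=\langle\beta(X,Y),\xi\rangle$; define $\mathcal Y\eta$, tangent to $f$, by $\langle\mathcal Y\eta,f_*X\rangle+\langle\eta,LX\rangle=0$,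 and, identifying $TM$ with $f_*TM$, put $$\mathcal E(X,\eta)=\alpha(X,\mathcal Y\eta)+(LA_\eta X)_{N_fM}.$$ Then $\beta$ and $\mathcal E$ are smooth tensors, $\beta$ is symmetric, $\langle\mathcal E(X,\eta),\xi\rangle+\langle\mathcal E(X,\xi),\eta\rangle=0$, and for all $X,Y,Z\in\mathfrak X(M)$ and $\eta\in\Gamma(N_fM)$ $$A_{\beta(Y,Z)}X+B_{\alpha(Y,Z)}X=A_{\beta(X,Z)}Y+B_{\alpha(X,Z)}Y,\tag{1}$$ $$(\nabla^\perp_X\beta)(Y,Z)-(\nabla^\perp_Y\beta)(X,Z)=\mathcal E(Y,\alpha(X,Z))-\mathcal E(X,\alpha(Y,Z)),\tag{2}$$ $$(\nabla^\perp_X\mathcal E)(Y,\eta)-(\nabla^\perp_Y\mathcal E)(X,\eta)=\beta(X,A_\eta Y)-\beta(A_\eta X,Y)+\alpha(X,B_\eta Y)-\alpha(B_\eta X,Y).\tag{3}$$ Moreover, (2) for all $X,Y,Z$ is equivalent to $$(\nabla_XB_\eta)Y-(\nabla_YB_\eta)X-B_{\nabla^\perp_X\eta}Y+B_{\nabla^\perp_Y\eta}X=A_{\mathcal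 E(X,\eta)}Y-A_{\mathcal E(Y,\eta)}X\tag{4}$$ for all $X,Y\in\mathfrak X(M)$ and $\eta\in\Gamma(N_fM)$. This equivalence holds for every pair of smooth tensors $\beta\colon TM\times TM\to N_fM$, $\mathcal E\colon TM\times N_fM\to N_fM$ with $\beta$ symmetric and $\langle\mathcal E(X,\eta),\xi\rangle+\langle\mathcal E(X,\xi),\eta\rangle=0$ (with $B_\eta$ defined from $\beta$ as above), whether or not it is associated to a bending. -/

import Mathlib

open Bundle FiberBundle Module
open scoped Manifold ContDiff Bundle InnerProductSpace

noncomputable section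

namespace InfinitesimalBending

variable {n m : ℕ} {M : Type*} [TopologicalSpace M]
  [ChartedSpace (EuclideanSpace ℝ (Fin n)) M]

/-- Smooth tangent vector fields on `M`. -/
def IsSmoothField [IsManifold (𝓡 n) ∞ M] (X : ∀ x : M, TangentSpace (𝓡 n) x) : Prop :=
  ContMDiff (𝓡 n) (𝓡 n).tangent ∞ (fun x => (⟨x, X x⟩ : TangentBundle (𝓡 n) M))

/-! ### The Levi-Civita connection -/

section Riemannian

variable [RiemannianBundle (fun x : M => TangentSpace (𝓡 n) x)]

/-- The tangent vector `u` at `x` with `⟪u, w⟫ = φ w` for all `w`, for a linear functional `φ`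
(see `inner_riesz`). -/
def riesz {x : M} (φ : TangentSpace (𝓡 n) x → ℝ) : TangentSpace (𝓡 n) x :=
  haveI : FiniteDimensional ℝ (TangentSpace (𝓡 n) x) :=
    inferInstanceAs (FiniteDimensional ℝ (EuclideanSpace ℝ (Fin n)))
  ∑ i, φ (stdOrthonormalBasis ℝ (TangentSpace (𝓡 n) x) i) •
    stdOrthonormalBasis ℝ (TangentSpace (𝓡 n) x) i

theorem inner_riesz {x : M} {φ : TangentSpace (𝓡 n) x → ℝ} (hφ : IsLinearMap ℝ φ)
    (w : TangentSpace (𝓡 n) x) : ⟪riesz φ, w⟫_ℝ = φ w := by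
  have : FiniteDimensional ℝ (TangentSpace (𝓡 n) x) :=
    inferInstanceAs (FiniteDimensional ℝ (EuclideanSpace ℝ (Fin n)))
  have h := congrArg (IsLinearMap.mk' φ hφ)
    ((stdOrthonormalBasis ℝ (TangentSpace (𝓡 n) x)).sum_repr' w)
  simp only [map_sum, map_smul, IsLinearMap.mk'_apply] at h
  rw [← h, riesz, sum_inner]
  refine Finset.sum_congr rfl fun i _ => ?_
  rw [real_inner_smul_left, smul_eq_mul, mul_comm]

variable [IsManifold (𝓡 n) ∞ M]

/-- The right hand side of the Koszul formula for `⟪∇_X Y, Z⟫` at `x`. -/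
def koszul (X Y Z : ∀ x : M, TangentSpace (𝓡 n) x) (x : M) : ℝ :=
  (1 / 2 : ℝ) *
    (mvfderiv (𝓡 n) (fun y => ⟪Y y, Z y⟫_ℝ) x (X x)
      + mvfderiv (𝓡 n) (fun y => ⟪X y, Z y⟫_ℝ) x (Y x)
      - mvfderiv (𝓡 n) (fun y => ⟪X y, Y y⟫_ℝ) x (Z x)
      + ⟪VectorField.mlieBracket (𝓡 n) X Y x, Z x⟫_ℝ
      - ⟪VectorField.mlieBracket (𝓡 n) X Z x, Y x⟫_ℝ
      - ⟪VectorField.mlieBracket (𝓡 n) Y Z x, X x⟫_ℝ)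

/-- The Levi-Civita connection of `M`: the vector `∇_v Y` at `x`, for a tangent vector `v` at `x`
and a vector field `Y`, determined by the Koszul formula (which is tensorial in the first and the
third argument, so that `v` and the test vector `w` may be extended to arbitrary fields). -/
def leviCivita {x : M} (v : TangentSpace (𝓡 n) x) (Y : ∀ x : M, TangentSpace (𝓡 n) x) :
    TangentSpace (𝓡 n) x :=
  riesz fun w => koszul (extend (EuclideanSpace ℝ (Fin n)) v) Y
    (extend (EuclideanSpace ℝ (Fin n)) w) x

/-- A torsion free connection compatible with the metric is the one given by `leviCivita`. -/
theorem eq_leviCivita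
    [IsContMDiffRiemannianBundle (𝓡 n) 1 (EuclideanSpace ℝ (Fin n))
      (fun x : M => TangentSpace (𝓡 n) x)]
    (cov : CovariantDerivative (𝓡 n) (EuclideanSpace ℝ (Fin n))
      (TangentSpace (𝓡 n) : M → Type _))
    (htor : cov.torsion = 0) (hmet : cov.IsMetricCompatible)
    {x : M} (v : TangentSpace (𝓡 n) x) {Y : ∀ x : M, TangentSpace (𝓡 n) x}
    (hY : MDifferentiableAt (𝓡 n) (𝓡 n).tangent
      (fun x => (⟨x, Y x⟩ : TangentBundle (𝓡 n) M)) x) :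
    leviCivita v Y = cov Y x v := by
  have key : ∀ w : TangentSpace (𝓡 n) x, koszul (extend (EuclideanSpace ℝ (Fin n)) v) Y
      (extend (EuclideanSpace ℝ (Fin n)) w) x = ⟪cov Y x v, w⟫_ℝ := by
    intro w
    have hv := mdifferentiableAt_extend (𝓡 n) (EuclideanSpace ℝ (Fin n)) v
    have hw := mdifferentiableAt_extend (𝓡 n) (EuclideanSpace ℝ (Fin n)) w
    have h1 := hmet.mvfderiv_inner_eq (extend (EuclideanSpace ℝ (Fin n)) v) hY hw
    have h2 := hmet.mvfderiv_inner_eq Y hv hw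
    have h3 := hmet.mvfderiv_inner_eq (extend (EuclideanSpace ℝ (Fin n)) w) hv hY
    unfold koszul
    rw [h1, h2, h3, ← cov.torsion_eq_zero_iff.1 htor hv hY,
      ← cov.torsion_eq_zero_iff.1 htor hv hw, ← cov.torsion_eq_zero_iff.1 htor hY hw]
    simp only [inner_sub_left, extend_apply_self]
    simp only [real_inner_comm]
    ring
  unfold leviCivita
  simp only [key]
  refine ext_inner_right ℝ fun w => inner_riesz ?_ w
  exact ⟨fun a b => inner_add_right _ _ _, fun c a => real_inner_smul_right _ _ _⟩

end Riemannian

/-! ### Normal bundle and normal connection -/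

/-- The normal space `N_f M(x)`. -/
abbrev normalSpace (n : ℕ) {M : Type*} [TopologicalSpace M]
    [ChartedSpace (EuclideanSpace ℝ (Fin n)) M] (f : M → EuclideanSpace ℝ (Fin m)) (x : M) :
    Submodule ℝ (EuclideanSpace ℝ (Fin m)) :=
  (mvfderiv (𝓡 n) f x).rangeᗮ

variable (n) in
/-- The component `(u)_{N_f M}` of `u` in the normal space at `x`. -/
def normalPart (f : M → EuclideanSpace ℝ (Fin m)) (x : M) (u : EuclideanSpace ℝ (Fin m)) :
    normalSpace n f x :=
  (normalSpace n f x).orthogonalProjectionOnto u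

variable (n) in
/-- Smooth sections of the normal bundle. -/
def IsSmoothNormal (f : M → EuclideanSpace ℝ (Fin m)) (η : ∀ x, normalSpace n f x) : Prop :=
  ContMDiff (𝓡 n) 𝓘(ℝ, EuclideanSpace ℝ (Fin m)) ∞ (fun x => (η x : EuclideanSpace ℝ (Fin m)))

/-- The normal connection `∇^⊥_v η`. -/
def normalConn (f : M → EuclideanSpace ℝ (Fin m)) {x : M} (v : TangentSpace (𝓡 n) x)
    (η : ∀ x, normalSpace n f x) : normalSpace n f x :=
  normalPart n f x (mvfderiv (𝓡 n) (fun y => (η y : EuclideanSpace ℝ (Fin m))) x v)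

variable [IsManifold (𝓡 n) ∞ M]

/-- The second fundamental form `α(v, w) = (∇̃_v f_* W)_{N_f M}`, with `W` extending `w`. -/
def sff (f : M → EuclideanSpace ℝ (Fin m)) (x : M) (v w : TangentSpace (𝓡 n) x) :
    normalSpace n f x :=
  normalPart n f x
    (mvfderiv (𝓡 n) (fun y => mvfderiv (𝓡 n) f y (extend (EuclideanSpace ℝ (Fin n)) w y)) x v)

/-! ### Isometric immersions, infinitesimal bendings and the associated pair -/

variable (n) in
/-- Infinitesimal bendings of `f`. Sections of `f^* T ℝ^m` are maps into `ℝ^m`, and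
`∇̃_v 𝓣 = 𝓣_* v` is the derivative of `𝓣` along `v`. -/
structure IsBending (f T : M → EuclideanSpace ℝ (Fin m)) : Prop where
  smooth : ContMDiff (𝓡 n) 𝓘(ℝ, EuclideanSpace ℝ (Fin m)) ∞ T
  skew : ∀ (x : M) (v w : TangentSpace (𝓡 n) x),
    ⟪mvfderiv (𝓡 n) T x v, mvfderiv (𝓡 n) f x w⟫_ℝ
      + ⟪mvfderiv (𝓡 n) f x v, mvfderiv (𝓡 n) T x w⟫_ℝ = 0

variable [RiemannianBundle (fun x : M => TangentSpace (𝓡 n) x)]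

variable (n) in
/-- Smooth isometric immersions into Euclidean space. -/
structure IsIsometricImmersion (f : M → EuclideanSpace ℝ (Fin m)) : Prop where
  smooth : ContMDiff (𝓡 n) 𝓘(ℝ, EuclideanSpace ℝ (Fin m)) ∞ f
  inner_eq : ∀ (x : M) (v w : TangentSpace (𝓡 n) x),
    ⟪mvfderiv (𝓡 n) f x v, mvfderiv (𝓡 n) f x w⟫_ℝ = ⟪v, w⟫_ℝ

/-- For a tensor `b : TM × TM → N_f M`, the operator `S_ξ` with `⟪S_ξ v, w⟫ = ⟪b(v, w), ξ⟫`.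
It gives `A_ξ` for `b = α` and `B_ξ` for `b = β`. -/
def shape {f : M → EuclideanSpace ℝ (Fin m)}
    (b : ∀ x : M, TangentSpace (𝓡 n) x → TangentSpace (𝓡 n) x → normalSpace n f x)
    (x : M) (ξ : normalSpace n f x) (v : TangentSpace (𝓡 n) x) : TangentSpace (𝓡 n) x :=
  riesz fun w => ⟪b x v w, ξ⟫_ℝ

/-- `B(v, w) = (∇̃_v L) W = ∇̃_v (L W) - L ∇_v W`, with `L = 𝓣_*` and `W` extending `w`. -/
def hessBending (T : M → EuclideanSpace ℝ (Fin m)) (x : M) (v w : TangentSpace (𝓡 n) x) :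
    EuclideanSpace ℝ (Fin m) :=
  mvfderiv (𝓡 n) (fun y => mvfderiv (𝓡 n) T y (extend (EuclideanSpace ℝ (Fin n)) w y)) x v
    - mvfderiv (𝓡 n) T x (leviCivita v (extend (EuclideanSpace ℝ (Fin n)) w))

variable (n) in
/-- `β(v, w) = (B(v, w))_{N_f M}`. -/
def beta (f T : M → EuclideanSpace ℝ (Fin m)) (x : M) (v w : TangentSpace (𝓡 n) x) :
    normalSpace n f x :=
  normalPart n f x (hessBending T x v w)

/-- The tangent vector `u` with `f_* u = 𝓨 η`, that is, `⟪u, w⟫ = -⟪η, L w⟫` for all `w`. -/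
def calY (f T : M → EuclideanSpace ℝ (Fin m)) (x : M) (η : normalSpace n f x) :
    TangentSpace (𝓡 n) x :=
  riesz fun w => -⟪(η : EuclideanSpace ℝ (Fin m)), mvfderiv (𝓡 n) T x w⟫_ℝ

variable (n) in
/-- `𝓔(v, η) = α(v, 𝓨 η) + (L A_η v)_{N_f M}`. -/
def calE (f T : M → EuclideanSpace ℝ (Fin m)) (x : M) (v : TangentSpace (𝓡 n) x)
    (η : normalSpace n f x) : normalSpace n f x :=
  sff f x v (calY f T x η) + normalPart n f x (mvfderiv (𝓡 n) T x (shape (sff f) x η v))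

/-! ### The fundamental system for a pair `(b, e)` -/

section System

variable {f : M → EuclideanSpace ℝ (Fin m)}
  (b : ∀ x : M, TangentSpace (𝓡 n) x → TangentSpace (𝓡 n) x → normalSpace n f x)
  (e : ∀ x : M, TangentSpace (𝓡 n) x → normalSpace n f x → normalSpace n f x)

/-- Smooth tensors `b : TM × TM → N_f M` and `e : TM × N_f M → N_f M` with `b` symmetric and
`⟪e(X, η), ξ⟫ + ⟪e(X, ξ), η⟫ = 0`. -/
structure IsCompatiblePair : Prop where
  bilin_b : ∀ x, IsBilinearMap ℝ (b x)
  bilin_e : ∀ x, IsBilinearMap ℝ (e x)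
  smooth_b : ∀ X Y : (∀ x : M, TangentSpace (𝓡 n) x), IsSmoothField X → IsSmoothField Y →
    IsSmoothNormal n f (fun x => b x (X x) (Y x))
  smooth_e : ∀ (X : ∀ x : M, TangentSpace (𝓡 n) x) (η : ∀ x, normalSpace n f x),
    IsSmoothField X → IsSmoothNormal n f η → IsSmoothNormal n f (fun x => e x (X x) (η x))
  symm : ∀ x v w, b x v w = b x w v
  anti : ∀ x v η ξ, ⟪e x v η, ξ⟫_ℝ + ⟪e x v ξ, η⟫_ℝ = 0

/-- `(∇^⊥_X b)(Y, Z)`. -/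
def covB (X Y Z : ∀ x : M, TangentSpace (𝓡 n) x) (x : M) : normalSpace n f x :=
  normalConn f (X x) (fun y => b y (Y y) (Z y)) - b x (leviCivita (X x) Y) (Z x)
    - b x (Y x) (leviCivita (X x) Z)

/-- `(∇^⊥_X e)(Y, η)`. -/
def covE (X Y : ∀ x : M, TangentSpace (𝓡 n) x) (η : ∀ x, normalSpace n f x) (x : M) :
    normalSpace n f x :=
  normalConn f (X x) (fun y => e y (Y y) (η y)) - e x (leviCivita (X x) Y) (η x)
    - e x (Y x) (normalConn f (X x) η)

/-- `(∇_X S_η) Y`, where `⟪S_η Y, Z⟫ = ⟪b(Y, Z), η⟫`. -/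
def covShape (X Y : ∀ x : M, TangentSpace (𝓡 n) x) (η : ∀ x, normalSpace n f x) (x : M) :
    TangentSpace (𝓡 n) x :=
  leviCivita (X x) (fun y => shape b y (η y) (Y y)) - shape b x (η x) (leviCivita (X x) Y)

def GaussEq : Prop :=
  ∀ X Y Z : (∀ x : M, TangentSpace (𝓡 n) x),
    IsSmoothField X → IsSmoothField Y → IsSmoothField Z → ∀ x : M,
    shape (sff f) x (b x (Y x) (Z x)) (X x) + shape b x (sff f x (Y x) (Z x)) (X x)
      = shape (sff f) x (b x (X x) (Z x)) (Y x) + shape b x (sff f x (X x) (Z x)) (Y x)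

def CodazziEq : Prop :=
  ∀ X Y Z : (∀ x : M, TangentSpace (𝓡 n) x),
    IsSmoothField X → IsSmoothField Y → IsSmoothField Z → ∀ x : M,
    covB b X Y Z x - covB b Y X Z x
      = e x (Y x) (sff f x (X x) (Z x)) - e x (X x) (sff f x (Y x) (Z x))

def RicciEq : Prop :=
  ∀ (X Y : ∀ x : M, TangentSpace (𝓡 n) x) (η : ∀ x, normalSpace n f x),
    IsSmoothField X → IsSmoothField Y → IsSmoothNormal n f η → ∀ x : M,
    covE e X Y η x - covE e Y X η x
      = b x (X x) (shape (sff f) x (η x) (Y x)) - b x (shape (sff f) x (η x) (X x)) (Y x)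
        + sff f x (X x) (shape b x (η x) (Y x)) - sff f x (shape b x (η x) (X x)) (Y x)

/-- The Codazzi equation in terms of the operators `S_η` of `b`. -/
def CodazziShapeEq : Prop :=
  ∀ (X Y : ∀ x : M, TangentSpace (𝓡 n) x) (η : ∀ x, normalSpace n f x),
    IsSmoothField X → IsSmoothField Y → IsSmoothNormal n f η → ∀ x : M,
    covShape b X Y η x - covShape b Y X η x
        - shape b x (normalConn f (X x) η) (Y x) + shape b x (normalConn f (Y x) η) (X x)
      = shape (sff f) x (e x (X x) (η x)) (Y x) - shape (sff f) x (e x (Y x) (η x)) (X x)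

end System

end InfinitesimalBending

end

open InfinitesimalBending

/-
An infinitesimal bending makes `L = 𝓣_*` a skew-symmetric form on the tangent spaces of `f`, and `𝓨`
is the unique extension of `L` to the normal spaces for which `J = L + 𝓨` is a field of
skew-symmetric endomorphisms of `ℝ^m` with `J ∘ f_* = 𝓣_*`. The form `⟪dJ(v) f_* w, f_* z⟫` is
skew-symmetric in `w, z`, and symmetric in `v, w` because the Hessians of `f` and `𝓣` are symmetric;
hence it vanishes, so that `dJ(v) f_* w = β(v, w)` and `dJ(v) ξ = -f_* B_ξ v + 𝓔(v, ξ)`. The Hessian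
of the map `J` is symmetric too: evaluated on tangent vectors, the tangential and the normal part of
this symmetry are the Gauss and the Codazzi equation, and on normal vectors the normal part is the
Ricci equation.
-/

noncomputable section

namespace InfinitesimalBending

section Calculus

open VectorField

variable {E : Type*} [NormedAddCommGroup E] [NormedSpace ℝ E]
  {H : Type*} [TopologicalSpace H] {I : ModelWithCorners ℝ E H}
  {M : Type*} [TopologicalSpace M] [ChartedSpace H M] {x : M}
  {V : Type*} [NormedAddCommGroup V]

section Product

variable {U : Type*} [NormedAddCommGroup U] {W : Type*} [NormedAddCommGroup W] [NormedSpace ℝ W]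

theorem mvfderiv_isBoundedBilinearMap [NormedSpace ℝ U] [NormedSpace ℝ V] {b : U × V → W}
    (hb : IsBoundedBilinearMap ℝ b) {u : M → U} {w : M → V} (hu : MDiffAt u x) (hw : MDiffAt w x)
    (v : TangentSpace I x) :
    d% (fun y => b (u y, w y)) x v = b (d% u x v, w x) + b (u x, d% w x v) := by
  have hprod : HasMFDerivAt I 𝓘(ℝ, U × V) (fun y => (u y, w y)) x ((d% u x).prod (d% w x)) :=
    ⟨hu.continuousAt.prodMk hw.continuousAt, hu.hasMFDerivAt.2.prodMk hw.hasMFDerivAt.2⟩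
  have hcomp := (hb.hasFDerivAt (u x, w x)).hasMFDerivAt.comp x hprod
  exact (DFunLike.congr_fun hcomp.mfderiv v).trans (add_comm _ _)

theorem mvfderiv_clm_apply [NormedSpace ℝ V] {A : M → V →L[ℝ] W} {u : M → V}
    (hA : MDiffAt A x) (hu : MDiffAt u x) (v : TangentSpace I x) :
    d% (fun y => A y (u y)) x v = d% A x v (u x) + A x (d% u x v) :=
  mvfderiv_isBoundedBilinearMap isBoundedBilinearMap_apply hA hu v

theorem mvfderiv_inner [InnerProductSpace ℝ V] {u w : M → V} (hu : MDiffAt u x)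
    (hw : MDiffAt w x) (v : TangentSpace I x) :
    d% (fun y => ⟪u y, w y⟫_ℝ) x v = ⟪d% u x v, w x⟫_ℝ + ⟪u x, d% w x v⟫_ℝ :=
  mvfderiv_isBoundedBilinearMap (b := fun p : V × V => ⟪p.1, p.2⟫_ℝ)
    isBoundedBilinearMap_inner hu hw v

end Product

variable [NormedSpace ℝ V]

theorem fderivWithin_lieBracketWithin {g : E → V} {X Y : E → E} {s : Set E} {z : E}
    (hs : UniqueDiffWithinAt ℝ s z) (hg : DifferentiableWithinAt ℝ (fderivWithin ℝ g s) s z)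
    (hsymm : IsSymmSndFDerivWithinAt ℝ g s z) (hX : DifferentiableWithinAt ℝ X s z)
    (hY : DifferentiableWithinAt ℝ Y s z) :
    fderivWithin ℝ g s z (lieBracketWithin ℝ X Y s z) =
      fderivWithin ℝ (fun y => fderivWithin ℝ g s y (Y y)) s z (X z)
        - fderivWithin ℝ (fun y => fderivWithin ℝ g s y (X y)) s z (Y z) := by
  rw [fderivWithin_clm_apply hs hg hX, fderivWithin_clm_apply hs hg hY, lieBracketWithin]
  simp [hsymm (X z) (Y z)]

theorem contMDiff_mvfderiv_apply [IsManifold I 1 M] {k l : ℕ∞ω} {g : M → V} (hg : CMDiff k g)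
    (hlk : l + 1 ≤ k) {Z : Π x : M, TangentSpace I x} (hZ : CMDiff l (T% Z)) :
    CMDiff l fun y => d% g y (Z y) :=
  (contMDiff_snd_tangentBundle_modelSpace V 𝓘(ℝ, V)).comp ((hg.contMDiff_tangentMap hlk).comp hZ)

variable (I) in
/-- The representation of the vector field `Z` in the extended chart of `M` at `x`, as a vector
field on the model space. -/
def chartField (x : M) (Z : Π x : M, TangentSpace I x) : E → E :=
  mpullbackWithin 𝓘(ℝ, E) I (extChartAt I x).symm Z (Set.range I)

variable {g : M → V} {X Y Z : Π x : M, TangentSpace I x}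

theorem mvfderiv_apply_eq_fderivWithin_chartField [IsManifold I 1 M] (hg : CMDiff 1 g)
    (Z : Π x : M, TangentSpace I x) {z : E} (hz : z ∈ (extChartAt I x).target) :
    d% g ((extChartAt I x).symm z) (Z ((extChartAt I x).symm z)) =
      fderivWithin ℝ (g ∘ (extChartAt I x).symm) (Set.range I) z (chartField I x Z z) := by
  have hchain := mfderiv_comp_mfderivWithin z (hg.mdifferentiableAt one_ne_zero)
    (mdifferentiableWithinAt_extChartAt_symm hz)
    (I.uniqueMDiffOn z (extChartAt_target_subset_range x hz))
  have hinv := (isInvertible_mfderivWithin_extChartAt_symm hz).self_apply_inverse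
    (Z ((extChartAt I x).symm z))
  rw [← mfderivWithin_eq_fderivWithin, hchain]
  exact (congrArg (d% g _) hinv).symm

theorem chartField_extChartAt [IsManifold I 1 M] (x : M) (Z : Π x : M, TangentSpace I x) :
    chartField I x Z (extChartAt I x x) = Z x := by
  rw [chartField, mpullbackWithin_apply, extChartAt_to_inv]
  exact mfderivWithin_extChartAt_symm_inverse_apply (Z x)

theorem mlieBracket_eq_lieBracketWithin_chartField [IsManifold I 1 M]
    (X Y : Π x : M, TangentSpace I x) (x : M) :
    mlieBracket I X Y x = lieBracketWithin ℝ (chartField I x X) (chartField I x Y) (Set.range I)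
      (extChartAt I x x) := by
  rw [← mlieBracketWithin_univ, mlieBracketWithin_apply, mfderiv_extChartAt_self,
    Set.preimage_univ, Set.univ_inter]
  exact DFunLike.congr_fun ContinuousLinearMap.inverse_id _

variable [IsManifold I 2 M]

theorem differentiableWithinAt_chartField [CompleteSpace E] (hZ : MDiffAt (T% Z) x) :
    DifferentiableWithinAt ℝ (chartField I x Z) (Set.range I) (extChartAt I x x) := by
  have h := (mdifferentiableWithinAt_univ.2 hZ).differentiableWithinAt_mpullbackWithin_vectorField
  rwa [Set.preimage_univ, Set.univ_inter] at h

theorem mdifferentiableAt_mvfderiv_apply (hg : CMDiff 2 g) (hZ : MDiffAt (T% Z) x) :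
    MDiffAt (fun y => d% g y (Z y)) x :=
  (((contMDiff_snd_tangentBundle_modelSpace V 𝓘(ℝ, V)).comp (hg.contMDiff_tangentMap (m := 1)
    one_add_one_eq_two.le)).mdifferentiableAt one_ne_zero).comp x hZ

theorem mvfderiv_mvfderiv_apply_eq_fderivWithin_chartField (hg : CMDiff 2 g)
    (hZ : MDiffAt (T% Z) x) (v : TangentSpace I x) :
    d% (fun y => d% g y (Z y)) x v =
      fderivWithin ℝ (fun z => fderivWithin ℝ (g ∘ (extChartAt I x).symm) (Set.range I) z
        (chartField I x Z z)) (Set.range I) (extChartAt I x x) v := by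
  rw [(mdifferentiableAt_mvfderiv_apply hg hZ).mvfderiv]
  have hchart : writtenInExtChartAt I 𝓘(ℝ, V) x (fun y => d% g y (Z y))
      =ᶠ[nhdsWithin (extChartAt I x x) (Set.range I)]
        fun z => fderivWithin ℝ (g ∘ (extChartAt I x).symm) (Set.range I) z
          (chartField I x Z z) := by
    filter_upwards [extChartAt_target_mem_nhdsWithin x] with z hz
    exact mvfderiv_apply_eq_fderivWithin_chartField (hg.of_le one_le_two) Z hz
  exact DFunLike.congr_fun (hchart.fderivWithin_eq_of_mem (Set.mem_range_self _)) v

theorem mvfderiv_mlieBracket [CompleteSpace E] (hg : CMDiff 2 g) (hX : MDiffAt (T% X) x)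
    (hY : MDiffAt (T% Y) x) :
    d% g x (mlieBracket I X Y x) =
      d% (fun y => d% g y (Y y)) x (X x) - d% (fun y => d% g y (X y)) x (Y x) := by
  have hrange : extChartAt I x x ∈ Set.range I := Set.mem_range_self _
  have hchart : ContDiffWithinAt ℝ 2 (g ∘ (extChartAt I x).symm) (Set.range I) (extChartAt I x x) :=
    (contMDiffAt_iff.1 hg.contMDiffAt).2
  have hdiff := (hchart.fderivWithin_right (m := 1) I.uniqueDiffOn one_add_one_eq_two.le
    hrange).differentiableWithinAt one_ne_zero
  have hsymm := hchart.isSymmSndFDerivWithinAt (by simp) I.uniqueDiffOn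
    (I.range_subset_closure_interior hrange) hrange
  have hbracket := fderivWithin_lieBracketWithin (I.uniqueDiffOn _ hrange) hdiff hsymm
    (differentiableWithinAt_chartField hX) (differentiableWithinAt_chartField hY)
  have hd := mvfderiv_apply_eq_fderivWithin_chartField (hg.of_le one_le_two) (mlieBracket I X Y)
    (mem_extChartAt_target x)
  rw [extChartAt_to_inv, chartField_extChartAt] at hd
  rw [← mlieBracket_eq_lieBracketWithin_chartField, chartField_extChartAt,
    chartField_extChartAt] at hbracket
  rw [mvfderiv_mvfderiv_apply_eq_fderivWithin_chartField hg hX,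
    mvfderiv_mvfderiv_apply_eq_fderivWithin_chartField hg hY]
  exact hd.trans hbracket

end Calculus

section Pseudoinverse

variable {V W : Type*} [NormedAddCommGroup V] [InnerProductSpace ℝ V]
  [NormedAddCommGroup W] [InnerProductSpace ℝ W] [CompleteSpace V] [CompleteSpace W]

theorem contDiff_adjoint {k : ℕ∞ω} :
    ContDiff ℝ k fun A : V →L[ℝ] W => ContinuousLinearMap.adjoint A :=
  (IsLinearMap.with_bound ⟨map_add _, fun c A => by simp⟩ 1 fun A => by simp).contDiff

/-- The Moore–Penrose inverse `(A† A)⁻¹ A†` of an injective operator `A`; it is `0` when `A† A` is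
not invertible. -/
def pseudoinverse (A : V →L[ℝ] W) : W →L[ℝ] V :=
  Ring.inverse (ContinuousLinearMap.adjoint A ∘L A) ∘L ContinuousLinearMap.adjoint A

variable [FiniteDimensional ℝ V] {A : V →L[ℝ] W}

theorem isUnit_adjoint_comp_self (hA : Function.Injective A) :
    IsUnit (ContinuousLinearMap.adjoint A ∘L A) := by
  rw [ContinuousLinearMap.isUnit_iff_isUnit_toLinearMap, LinearMap.isUnit_iff_ker_eq_bot,
    LinearMap.ker_eq_bot']
  intro c hc
  have hAc : ⟪A c, A c⟫_ℝ = 0 := by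
    rw [← ContinuousLinearMap.adjoint_inner_left]
    exact (congrArg (⟪·, c⟫_ℝ) hc).trans (inner_zero_left c)
  exact hA ((inner_self_eq_zero.1 hAc).trans (map_zero A).symm)

theorem pseudoinverse_apply_eq (hA : Function.Injective A) {u : W} {c : V}
    (h : ∀ w, ⟪A c, A w⟫_ℝ = ⟪u, A w⟫_ℝ) : pseudoinverse A u = c := by
  have hc : ContinuousLinearMap.adjoint A u = (ContinuousLinearMap.adjoint A ∘L A) c :=
    ext_inner_right ℝ fun w => by
      simp only [ContinuousLinearMap.comp_apply, ContinuousLinearMap.adjoint_inner_left, h]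
  rw [pseudoinverse, ContinuousLinearMap.comp_apply, hc, ← mul_apply_eq_comp,
    Ring.inverse_mul_cancel _ (isUnit_adjoint_comp_self hA), one_apply_eq_self]

theorem contDiffAt_pseudoinverse (hA : Function.Injective A) {k : ℕ∞ω} :
    ContDiffAt ℝ k (pseudoinverse (V := V) (W := W)) A := by
  have hadj : ContDiffAt ℝ k (fun A : V →L[ℝ] W => ContinuousLinearMap.adjoint A) A :=
    contDiff_adjoint.contDiffAt
  obtain ⟨G, hG⟩ := isUnit_adjoint_comp_self hA
  have hinv : ContDiffAt ℝ k Ring.inverse (ContinuousLinearMap.adjoint A ∘L A) :=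
    hG ▸ contDiffAt_ringInverse ℝ G
  have hgramInv : ContDiffAt ℝ k
      (fun A : V →L[ℝ] W => Ring.inverse (ContinuousLinearMap.adjoint A ∘L A)) A :=
    ContDiffAt.comp (f := fun A : V →L[ℝ] W => ContinuousLinearMap.adjoint A ∘L A) A hinv
      (hadj.clm_comp contDiffAt_id)
  exact hgramInv.clm_comp hadj

end Pseudoinverse

section Trivialization

variable {E : Type*} [NormedAddCommGroup E] [NormedSpace ℝ E]
  {H : Type*} [TopologicalSpace H] {I : ModelWithCorners ℝ E H}
  {M : Type*} [TopologicalSpace M] [ChartedSpace H M] [IsManifold I 1 M]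
  {V : Type*} [NormedAddCommGroup V] [NormedSpace ℝ V]

variable (I) in
/-- The differential of `g` at `y`, read in the trivialization of the tangent bundle at `x`. -/
def localDeriv (g : M → V) (x y : M) : E →L[ℝ] V :=
  (d% g y) ∘L (trivializationAt E (TangentSpace I) x).symmL ℝ y

theorem localDeriv_trivializationAt {g : M → V} {x y : M}
    (hy : y ∈ (trivializationAt E (TangentSpace I) x).baseSet) (v : TangentSpace I y) :
    localDeriv I g x y (trivializationAt E (TangentSpace I) x ⟨y, v⟩).2 = d% g y v := by
  rw [localDeriv, ContinuousLinearMap.comp_apply, Trivialization.symmL_apply _ hy]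
  exact congrArg _ (Trivialization.symm_apply_apply_mk _ hy v)

theorem localDeriv_injective {g : M → V} {x y : M}
    (hy : y ∈ (trivializationAt E (TangentSpace I) x).baseSet)
    (hg : Function.Injective (d% g y)) : Function.Injective (localDeriv I g x y) :=
  hg.comp (Function.LeftInverse.injective
    (Trivialization.continuousLinearMapAt_symmL (R := ℝ) _ hy))

theorem contMDiffAt_localDeriv {k l : ℕ∞ω} {g : M → V} (hg : CMDiff k g) (hlk : l + 1 ≤ k)
    (x : M) : CMDiffAt l (localDeriv I g x) x := by
  refine (hg.contMDiffAt.mfderiv_const hlk).congr_of_eventuallyEq ?_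
  filter_upwards [(chartAt H x).open_source.mem_nhds (mem_chart_source _ x)] with y hy
  rw [localDeriv, TangentBundle.symmL_trivializationAt_eq_core hy]
  refine Eq.trans ?_ (inTangentCoordinates_eq (I := I) (I' := 𝓘(ℝ, V)) id g
    (fun y => mfderiv I 𝓘(ℝ, V) g y) (x₀ := x) (x := y) hy (Set.mem_univ _)).symm
  rw [tangentBundleCore_coordChange_model_space, ContinuousLinearMap.id_comp]
  rfl

end Trivialization

section TangentProjection

variable {n m : ℕ} {M : Type*} [TopologicalSpace M] [ChartedSpace (EuclideanSpace ℝ (Fin n)) M]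
  [RiemannianBundle (fun x : M => TangentSpace (𝓡 n) x)]
  {f g : M → EuclideanSpace ℝ (Fin m)}

theorem riesz_eq {x : M} {φ : TangentSpace (𝓡 n) x → ℝ} {u : TangentSpace (𝓡 n) x}
    (h : ∀ w, ⟪u, w⟫_ℝ = φ w) : riesz φ = u := by
  obtain rfl : (fun w => ⟪u, w⟫_ℝ) = φ := funext h
  exact ext_inner_right ℝ (inner_riesz (innerₗ _ u).isLinear)

variable (n) in
/-- The adjoint `ℝ^m → T_x M` of the differential of `f`; for an isometric immersion, it takes a
vector to its tangential component. -/
def pullTangent (f : M → EuclideanSpace ℝ (Fin m)) (x : M) :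
    EuclideanSpace ℝ (Fin m) →ₗ[ℝ] TangentSpace (𝓡 n) x :=
  haveI : FiniteDimensional ℝ (TangentSpace (𝓡 n) x) :=
    inferInstanceAs (FiniteDimensional ℝ (EuclideanSpace ℝ (Fin n)))
  LinearMap.adjoint (mvfderiv (𝓡 n) f x).toLinearMap

theorem inner_pullTangent (f : M → EuclideanSpace ℝ (Fin m)) (x : M)
    (u : EuclideanSpace ℝ (Fin m)) (w : TangentSpace (𝓡 n) x) :
    ⟪pullTangent n f x u, w⟫_ℝ = ⟪u, mvfderiv (𝓡 n) f x w⟫_ℝ :=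
  haveI : FiniteDimensional ℝ (TangentSpace (𝓡 n) x) :=
    inferInstanceAs (FiniteDimensional ℝ (EuclideanSpace ℝ (Fin n)))
  LinearMap.adjoint_inner_left (mvfderiv (𝓡 n) f x).toLinearMap w u

variable (n) in
/-- The endomorphism `g_* ∘ (f_*)^*` of `ℝ^m` at `x`. For `g = f` it is the orthogonal projection
onto the tangent space of an isometric immersion `f`. -/
def pushPull (f g : M → EuclideanSpace ℝ (Fin m)) (x : M) :
    EuclideanSpace ℝ (Fin m) →L[ℝ] EuclideanSpace ℝ (Fin m) :=
  LinearMap.toContinuousLinearMap ((mvfderiv (𝓡 n) g x).toLinearMap ∘ₗ pullTangent n f x)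

theorem pushPull_apply (f g : M → EuclideanSpace ℝ (Fin m)) (x : M)
    (u : EuclideanSpace ℝ (Fin m)) :
    pushPull n f g x u = mvfderiv (𝓡 n) g x (pullTangent n f x u) :=
  rfl

namespace IsIsometricImmersion

theorem pullTangent_mvfderiv (hf : IsIsometricImmersion n f) (x : M) (v : TangentSpace (𝓡 n) x) :
    pullTangent n f x (mvfderiv (𝓡 n) f x v) = v :=
  ext_inner_right ℝ fun w => by rw [inner_pullTangent, hf.inner_eq]

theorem mvfderiv_injective (hf : IsIsometricImmersion n f) (x : M) :
    Function.Injective (mvfderiv (𝓡 n) f x) :=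
  Function.LeftInverse.injective (hf.pullTangent_mvfderiv x)

variable [IsManifold (𝓡 n) ∞ M]

theorem trivializationAt_pullTangent (hf : IsIsometricImmersion n f) {x y : M}
    (hy : y ∈ (trivializationAt (EuclideanSpace ℝ (Fin n)) (TangentSpace (𝓡 n)) x).baseSet)
    (u : EuclideanSpace ℝ (Fin m)) :
    (trivializationAt (EuclideanSpace ℝ (Fin n)) (TangentSpace (𝓡 n)) x
      ⟨y, pullTangent n f y u⟩).2 = pseudoinverse (localDeriv (𝓡 n) f x y) u := by
  refine (pseudoinverse_apply_eq (localDeriv_injective hy (hf.mvfderiv_injective y))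
    fun w => ?_).symm
  rw [localDeriv_trivializationAt hy]
  exact (hf.inner_eq y _ _).trans (inner_pullTangent f y u _)

theorem contMDiffAt_pseudoinverse_localDeriv (hf : IsIsometricImmersion n f) (x : M) :
    ContMDiffAt (𝓡 n) 𝓘(ℝ, EuclideanSpace ℝ (Fin m) →L[ℝ] EuclideanSpace ℝ (Fin n)) ∞
      (fun y => pseudoinverse (localDeriv (𝓡 n) f x y)) x :=
  (contDiffAt_pseudoinverse (localDeriv_injective (mem_baseSet_trivializationAt' x)
    (hf.mvfderiv_injective x))).contMDiffAt.comp x (contMDiffAt_localDeriv hf.smooth le_rfl x)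

theorem isSmoothField_pullTangent (hf : IsIsometricImmersion n f)
    {u : M → EuclideanSpace ℝ (Fin m)} (hu : ContMDiff (𝓡 n) 𝓘(ℝ, EuclideanSpace ℝ (Fin m)) ∞ u) :
    IsSmoothField fun x => pullTangent n f x (u x) := by
  intro x
  rw [contMDiffAt_section]
  refine ((hf.contMDiffAt_pseudoinverse_localDeriv x).clm_apply (hu x)).congr_of_eventuallyEq ?_
  filter_upwards [(trivializationAt (EuclideanSpace ℝ (Fin n)) (TangentSpace (𝓡 n)) x
    ).open_baseSet.mem_nhds (mem_baseSet_trivializationAt' x)] with y hy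
  exact hf.trivializationAt_pullTangent hy (u y)

theorem contMDiff_pushPull (hf : IsIsometricImmersion n f)
    (hg : ContMDiff (𝓡 n) 𝓘(ℝ, EuclideanSpace ℝ (Fin m)) ∞ g) :
    ContMDiff (𝓡 n) 𝓘(ℝ, EuclideanSpace ℝ (Fin m) →L[ℝ] EuclideanSpace ℝ (Fin m)) ∞
      (pushPull n f g) := by
  intro x
  refine ((contMDiffAt_localDeriv hg le_rfl x).clm_comp
    (hf.contMDiffAt_pseudoinverse_localDeriv x)).congr_of_eventuallyEq ?_
  filter_upwards [(trivializationAt (EuclideanSpace ℝ (Fin n)) (TangentSpace (𝓡 n)) x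
    ).open_baseSet.mem_nhds (mem_baseSet_trivializationAt' x)] with y hy
  ext1 u
  rw [pushPull_apply, ContinuousLinearMap.comp_apply, ← hf.trivializationAt_pullTangent hy,
    localDeriv_trivializationAt hy]

theorem exists_isSmoothField (hf : IsIsometricImmersion n f) {x : M} (v : TangentSpace (𝓡 n) x) :
    ∃ X : ∀ x : M, TangentSpace (𝓡 n) x, IsSmoothField X ∧ X x = v :=
  ⟨_, hf.isSmoothField_pullTangent contMDiff_const, hf.pullTangent_mvfderiv x v⟩

end IsIsometricImmersion

end TangentProjection

section NormalBundle

variable {n m : ℕ} {M : Type*} [TopologicalSpace M] [ChartedSpace (EuclideanSpace ℝ (Fin n)) M]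
  {f : M → EuclideanSpace ℝ (Fin m)}

theorem inner_normal_mvfderiv (x : M) (η : normalSpace n f x) (w : TangentSpace (𝓡 n) x) :
    ⟪(η : EuclideanSpace ℝ (Fin m)), mvfderiv (𝓡 n) f x w⟫_ℝ = 0 :=
  (Submodule.mem_orthogonal' _ _).1 η.2 _ ⟨w, rfl⟩

theorem isLinearMap_normalPart (x : M) : IsLinearMap ℝ (normalPart n f x) :=
  (normalSpace n f x).orthogonalProjectionOnto.isLinear

theorem isBilinearMap_normalPart {U₁ U₂ : Type*} [AddCommGroup U₁] [Module ℝ U₁]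
    [TopologicalSpace U₁] [AddCommGroup U₂] [Module ℝ U₂] (x : M)
    (Φ : U₁ →L[ℝ] EuclideanSpace ℝ (Fin m) →L[ℝ] EuclideanSpace ℝ (Fin m))
    (A : U₂ →ₗ[ℝ] EuclideanSpace ℝ (Fin m)) :
    IsBilinearMap ℝ fun v w => normalPart n f x (Φ v (A w)) where
  add_left v v' w := by simp [(isLinearMap_normalPart x).map_add]
  smul_left c v w := by simp [(isLinearMap_normalPart x).map_smul]
  add_right v w w' := by simp [(isLinearMap_normalPart x).map_add]
  smul_right c v w := by simp [(isLinearMap_normalPart x).map_smul]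

theorem normalPart_mvfderiv (x : M) (w : TangentSpace (𝓡 n) x) :
    normalPart n f x (mvfderiv (𝓡 n) f x w) = 0 :=
  Submodule.orthogonalProjectionOnto_orthogonal_apply_eq_zero ⟨w, rfl⟩

theorem normalPart_normal (x : M) (η : normalSpace n f x) : normalPart n f x η = η :=
  Submodule.orthogonalProjectionOnto_mem_subspace_eq_self η

theorem inner_normalPart (x : M) (u : EuclideanSpace ℝ (Fin m)) (η : normalSpace n f x) :
    ⟪normalPart n f x u, η⟫_ℝ = ⟪u, (η : EuclideanSpace ℝ (Fin m))⟫_ℝ :=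
  Submodule.inner_orthogonalProjectionOnto_eq_of_mem_right η u

theorem IsSmoothField.mdifferentiableAt [IsManifold (𝓡 n) ∞ M]
    {X : ∀ x : M, TangentSpace (𝓡 n) x} (hX : IsSmoothField X) (x : M) :
    MDifferentiableAt (𝓡 n) (𝓡 n).tangent (T% X) x :=
  (hX x).mdifferentiableAt (by simp)

theorem IsSmoothNormal.mdifferentiableAt {η : ∀ x, normalSpace n f x} (hη : IsSmoothNormal n f η)
    (x : M) : MDifferentiableAt (𝓡 n) 𝓘(ℝ, EuclideanSpace ℝ (Fin m))
      (fun y => (η y : EuclideanSpace ℝ (Fin m))) x :=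
  (hη x).mdifferentiableAt (by simp)

theorem mvfderiv_inner_normal {η ξ : ∀ x, normalSpace n f x} (hη : IsSmoothNormal n f η)
    (hξ : IsSmoothNormal n f ξ) {x : M} (v : TangentSpace (𝓡 n) x) :
    mvfderiv (𝓡 n) (fun y => ⟪η y, ξ y⟫_ℝ) x v =
      ⟪normalConn f v η, ξ x⟫_ℝ + ⟪η x, normalConn f v ξ⟫_ℝ := by
  rw [normalConn, normalConn, inner_normalPart, real_inner_comm (normalPart n f x _),
    inner_normalPart, real_inner_comm (η x : EuclideanSpace ℝ (Fin m))]
  exact mvfderiv_inner (hη.mdifferentiableAt x) (hξ.mdifferentiableAt x) v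

end NormalBundle

section Immersion

variable {n m : ℕ} {M : Type*} [TopologicalSpace M] [ChartedSpace (EuclideanSpace ℝ (Fin n)) M]
  [RiemannianBundle (fun x : M => TangentSpace (𝓡 n) x)] {f : M → EuclideanSpace ℝ (Fin m)}

theorem inner_shape {b : ∀ x : M, TangentSpace (𝓡 n) x → TangentSpace (𝓡 n) x → normalSpace n f x}
    {x : M} (hb : IsBilinearMap ℝ (b x)) (ξ : normalSpace n f x) (v w : TangentSpace (𝓡 n) x) :
    ⟪shape b x ξ v, w⟫_ℝ = ⟪b x v w, ξ⟫_ℝ :=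
  inner_riesz (φ := fun w => ⟪b x v w, ξ⟫_ℝ)
    ⟨fun a c => by rw [hb.add_right, inner_add_left],
      fun c a => by rw [hb.smul_right, real_inner_smul_left, smul_eq_mul]⟩ w

theorem pullTangent_normal (x : M) (η : normalSpace n f x) :
    pullTangent n f x (η : EuclideanSpace ℝ (Fin m)) = 0 :=
  ext_inner_right ℝ fun w => by
    rw [inner_pullTangent, inner_zero_left, inner_normal_mvfderiv]

/-- The second covariant derivative `(∇ dg)(v, Y) = v(Y g) - dg(∇_v Y)` of a vector-valued map
`g`. -/
def hessian [IsManifold (𝓡 n) ∞ M] {V : Type*} [NormedAddCommGroup V] [NormedSpace ℝ V]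
    (g : M → V) {x : M} (v : TangentSpace (𝓡 n) x) (Y : ∀ x : M, TangentSpace (𝓡 n) x) : V :=
  mvfderiv (𝓡 n) (fun y => mvfderiv (𝓡 n) g y (Y y)) x v - mvfderiv (𝓡 n) g x (leviCivita v Y)

namespace IsIsometricImmersion

theorem mvfderiv_pullTangent_add_normalPart (hf : IsIsometricImmersion n f) (x : M)
    (u : EuclideanSpace ℝ (Fin m)) :
    mvfderiv (𝓡 n) f x (pullTangent n f x u) + normalPart n f x u = u := by
  have hnormal : u - mvfderiv (𝓡 n) f x (pullTangent n f x u) ∈ normalSpace n f x := by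
    rw [Submodule.mem_orthogonal']
    rintro _ ⟨w, rfl⟩
    rw [inner_sub_left, sub_eq_zero]
    exact (inner_pullTangent f x u w).symm.trans (hf.inner_eq x _ w).symm
  have h := normalPart_normal x ⟨_, hnormal⟩
  rw [(isLinearMap_normalPart x).map_sub, normalPart_mvfderiv, sub_zero] at h
  rw [h, add_sub_cancel]

variable [IsManifold (𝓡 n) ∞ M]

theorem isSmoothNormal_normalPart (hf : IsIsometricImmersion n f)
    {u : M → EuclideanSpace ℝ (Fin m)} (hu : ContMDiff (𝓡 n) 𝓘(ℝ, EuclideanSpace ℝ (Fin m)) ∞ u) :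
    IsSmoothNormal n f fun x => normalPart n f x (u x) := by
  refine (hu.sub ((hf.contMDiff_pushPull hf.smooth).clm_apply hu)).congr fun x => ?_
  exact eq_sub_of_add_eq' (hf.mvfderiv_pullTangent_add_normalPart x (u x))

theorem exists_isSmoothNormal (hf : IsIsometricImmersion n f) {x : M} (ξ : normalSpace n f x) :
    ∃ η : ∀ x, normalSpace n f x, IsSmoothNormal n f η ∧ η x = ξ :=
  ⟨_, hf.isSmoothNormal_normalPart contMDiff_const, normalPart_normal x ξ⟩

variable {x : M} {X Y Z : ∀ x : M, TangentSpace (𝓡 n) x}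

theorem leviCivita_eq (hf : IsIsometricImmersion n f) (v : TangentSpace (𝓡 n) x)
    (hY : MDifferentiableAt (𝓡 n) (𝓡 n).tangent (T% Y) x) :
    leviCivita v Y =
      pullTangent n f x (mvfderiv (𝓡 n) (fun y => mvfderiv (𝓡 n) f y (Y y)) x v) := by
  refine riesz_eq fun w => ?_
  have hf₂ : ContMDiff (𝓡 n) 𝓘(ℝ, EuclideanSpace ℝ (Fin m)) 2 f :=
    hf.smooth.of_le ENat.LEInfty.out
  have hv := mdifferentiableAt_extend (𝓡 n) (EuclideanSpace ℝ (Fin n)) v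
  have hw := mdifferentiableAt_extend (𝓡 n) (EuclideanSpace ℝ (Fin n)) w
  have hfv := mdifferentiableAt_mvfderiv_apply hf₂ hv
  have hfw := mdifferentiableAt_mvfderiv_apply hf₂ hw
  have hfY := mdifferentiableAt_mvfderiv_apply hf₂ hY
  rw [inner_pullTangent]
  simp only [koszul, ← hf.inner_eq]
  rw [mvfderiv_inner hfY hfw, mvfderiv_inner hfv hfw, mvfderiv_inner hfv hfY,
    mvfderiv_mlieBracket hf₂ hv hY, mvfderiv_mlieBracket hf₂ hv hw, mvfderiv_mlieBracket hf₂ hY hw]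
  simp only [extend_apply_self, inner_sub_left, real_inner_comm]
  ring

theorem mlieBracket_eq (hf : IsIsometricImmersion n f)
    (hX : MDifferentiableAt (𝓡 n) (𝓡 n).tangent (T% X) x)
    (hY : MDifferentiableAt (𝓡 n) (𝓡 n).tangent (T% Y) x) :
    VectorField.mlieBracket (𝓡 n) X Y x = leviCivita (X x) Y - leviCivita (Y x) X := by
  rw [← hf.pullTangent_mvfderiv x (VectorField.mlieBracket (𝓡 n) X Y x),
    mvfderiv_mlieBracket (hf.smooth.of_le ENat.LEInfty.out) hX hY, map_sub,
    hf.leviCivita_eq _ hX, hf.leviCivita_eq _ hY]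

theorem hessian_symm (hf : IsIsometricImmersion n f) {V : Type*} [NormedAddCommGroup V]
    [NormedSpace ℝ V] {g : M → V} (hg : ContMDiff (𝓡 n) 𝓘(ℝ, V) 2 g)
    (hX : MDifferentiableAt (𝓡 n) (𝓡 n).tangent (T% X) x)
    (hY : MDifferentiableAt (𝓡 n) (𝓡 n).tangent (T% Y) x) :
    hessian g (X x) Y = hessian g (Y x) X := by
  rw [hessian, hessian, sub_eq_sub_iff_sub_eq_sub, ← mvfderiv_mlieBracket hg hX hY,
    hf.mlieBracket_eq hX hY, map_sub]

theorem mvfderiv_inner_field (hf : IsIsometricImmersion n f)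
    (hY : MDifferentiableAt (𝓡 n) (𝓡 n).tangent (T% Y) x)
    (hZ : MDifferentiableAt (𝓡 n) (𝓡 n).tangent (T% Z) x) (v : TangentSpace (𝓡 n) x) :
    mvfderiv (𝓡 n) (fun y => ⟪Y y, Z y⟫_ℝ) x v =
      ⟪leviCivita v Y, Z x⟫_ℝ + ⟪Y x, leviCivita v Z⟫_ℝ := by
  have hf₂ : ContMDiff (𝓡 n) 𝓘(ℝ, EuclideanSpace ℝ (Fin m)) 2 f :=
    hf.smooth.of_le ENat.LEInfty.out
  rw [hf.leviCivita_eq v hY, hf.leviCivita_eq v hZ, inner_pullTangent, real_inner_comm _ (Y x),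
    inner_pullTangent, real_inner_comm (mvfderiv (𝓡 n) f x (Y x)), ← mvfderiv_inner
      (mdifferentiableAt_mvfderiv_apply hf₂ hY) (mdifferentiableAt_mvfderiv_apply hf₂ hZ)]
  simp only [hf.inner_eq]

theorem normalPart_mvfderiv_mvfderiv (hf : IsIsometricImmersion n f) (v : TangentSpace (𝓡 n) x)
    (hY : MDifferentiableAt (𝓡 n) (𝓡 n).tangent (T% Y) x) :
    normalPart n f x (mvfderiv (𝓡 n) (fun y => mvfderiv (𝓡 n) f y (Y y)) x v) =
      normalPart n f x (mvfderiv (𝓡 n) (pushPull n f f) x v (mvfderiv (𝓡 n) f x (Y x))) := by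
  have h := mvfderiv_clm_apply ((hf.contMDiff_pushPull hf.smooth x).mdifferentiableAt (by simp))
    (mdifferentiableAt_mvfderiv_apply (hf.smooth.of_le ENat.LEInfty.out) hY) v
  simp only [pushPull_apply, hf.pullTangent_mvfderiv] at h
  conv_lhs => rw [h]
  rw [(isLinearMap_normalPart x).map_add, normalPart_mvfderiv, add_zero]

theorem sff_eq (hf : IsIsometricImmersion n f) (x : M) (v w : TangentSpace (𝓡 n) x) :
    sff f x v w =
      normalPart n f x (mvfderiv (𝓡 n) (pushPull n f f) x v (mvfderiv (𝓡 n) f x w)) := by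
  rw [sff, hf.normalPart_mvfderiv_mvfderiv v
    (mdifferentiableAt_extend (𝓡 n) (EuclideanSpace ℝ (Fin n)) w), extend_apply_self]

theorem isBilinearMap_sff (hf : IsIsometricImmersion n f) (x : M) :
    IsBilinearMap ℝ (sff (n := n) f x) :=
  (funext₂ (hf.sff_eq x)).symm ▸ isBilinearMap_normalPart x _ (mvfderiv (𝓡 n) f x).toLinearMap

theorem hessian_self (hf : IsIsometricImmersion n f) (v : TangentSpace (𝓡 n) x)
    (hY : MDifferentiableAt (𝓡 n) (𝓡 n).tangent (T% Y) x) : hessian f v Y = sff f x v (Y x) := by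
  rw [hessian, hf.leviCivita_eq v hY, hf.sff_eq, ← hf.normalPart_mvfderiv_mvfderiv v hY]
  exact sub_eq_of_eq_add' (hf.mvfderiv_pullTangent_add_normalPart x _).symm

theorem mvfderiv_mvfderiv_eq (hf : IsIsometricImmersion n f) (v : TangentSpace (𝓡 n) x)
    (hY : MDifferentiableAt (𝓡 n) (𝓡 n).tangent (T% Y) x) :
    mvfderiv (𝓡 n) (fun y => mvfderiv (𝓡 n) f y (Y y)) x v =
      mvfderiv (𝓡 n) f x (leviCivita v Y) + sff f x v (Y x) :=
  eq_add_of_sub_eq' (hf.hessian_self v hY)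

theorem sff_symm (hf : IsIsometricImmersion n f) (x : M) (v w : TangentSpace (𝓡 n) x) :
    sff f x v w = sff f x w v := by
  obtain ⟨X, hX, rfl⟩ := hf.exists_isSmoothField v
  obtain ⟨Y, hY, rfl⟩ := hf.exists_isSmoothField w
  rw [Subtype.ext_iff, ← hf.hessian_self _ (hY.mdifferentiableAt x),
    ← hf.hessian_self _ (hX.mdifferentiableAt x),
    hf.hessian_symm (hf.smooth.of_le ENat.LEInfty.out) (hX.mdifferentiableAt x)
      (hY.mdifferentiableAt x)]

theorem mvfderiv_normal_eq (hf : IsIsometricImmersion n f) (v : TangentSpace (𝓡 n) x)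
    {η : ∀ x, normalSpace n f x} (hη : IsSmoothNormal n f η) :
    mvfderiv (𝓡 n) (fun y => (η y : EuclideanSpace ℝ (Fin m))) x v =
      -mvfderiv (𝓡 n) f x (shape (sff f) x (η x) v) + normalConn f v η := by
  have hshape : shape (sff f) x (η x) v =
      -pullTangent n f x (mvfderiv (𝓡 n) (fun y => (η y : EuclideanSpace ℝ (Fin m))) x v) := by
    refine riesz_eq fun w => ?_
    obtain ⟨W, hW, rfl⟩ := hf.exists_isSmoothField w
    have h := mvfderiv_inner (hη.mdifferentiableAt x) (mdifferentiableAt_mvfderiv_apply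
      (hf.smooth.of_le ENat.LEInfty.out) (hW.mdifferentiableAt x)) v
    simp only [inner_normal_mvfderiv, mvfderiv_const, zero_apply] at h
    rw [hf.mvfderiv_mvfderiv_eq v (hW.mdifferentiableAt x), inner_add_right,
      inner_normal_mvfderiv, zero_add] at h
    rw [inner_neg_left, inner_pullTangent, Submodule.coe_inner,
      real_inner_comm (η x : EuclideanSpace ℝ (Fin m))]
    exact (eq_neg_of_add_eq_zero_right h.symm).symm
  rw [hshape, map_neg, neg_neg]
  exact (hf.mvfderiv_pullTangent_add_normalPart x _).symm

end IsIsometricImmersion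

end Immersion

section Rotation

variable {n m : ℕ} {M : Type*} [TopologicalSpace M] [ChartedSpace (EuclideanSpace ℝ (Fin n)) M]
  [RiemannianBundle (fun x : M => TangentSpace (𝓡 n) x)]
  {f T : M → EuclideanSpace ℝ (Fin m)}

variable (n) in
/-- The skew-symmetric endomorphism of `ℝ^m` at `x` that extends `L = 𝓣_*` from the tangent space of
`f` by `𝓨` on the normal space. With `P = pushPull n f T x` it is `P` on the tangent space, and
skew-symmetry forces it to be `-P†` on the normal space. -/
def rotation (f T : M → EuclideanSpace ℝ (Fin m)) (x : M) :
    EuclideanSpace ℝ (Fin m) →L[ℝ] EuclideanSpace ℝ (Fin m) :=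
  pushPull n f T x - ContinuousLinearMap.adjoint (pushPull n f T x) ∘L
    (ContinuousLinearMap.id ℝ _ - pushPull n f f x)

theorem inner_calY (x : M) (η : normalSpace n f x) (w : TangentSpace (𝓡 n) x) :
    ⟪calY f T x η, w⟫_ℝ = -⟪(η : EuclideanSpace ℝ (Fin m)), mvfderiv (𝓡 n) T x w⟫_ℝ :=
  inner_riesz (φ := fun w => -⟪(η : EuclideanSpace ℝ (Fin m)), mvfderiv (𝓡 n) T x w⟫_ℝ)
    ⟨fun a c => by rw [map_add, inner_add_right, neg_add],
      fun c a => by rw [map_smul, real_inner_smul_right, smul_eq_mul, mul_neg]⟩ w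

theorem rotation_normal (x : M) (η : normalSpace n f x) :
    rotation n f T x η = mvfderiv (𝓡 n) f x (calY f T x η) := by
  have hadjoint : rotation n f T x η = -ContinuousLinearMap.adjoint (pushPull n f T x) η := by
    simp [rotation, pushPull_apply, pullTangent_normal]
  rw [hadjoint]
  refine ext_inner_right ℝ fun u => ?_
  rw [inner_neg_left, ContinuousLinearMap.adjoint_inner_left, pushPull_apply, ← inner_calY,
    real_inner_comm, inner_pullTangent, real_inner_comm]

namespace IsIsometricImmersion

theorem rotation_mvfderiv (hf : IsIsometricImmersion n f) (x : M) (v : TangentSpace (𝓡 n) x) :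
    rotation n f T x (mvfderiv (𝓡 n) f x v) = mvfderiv (𝓡 n) T x v := by
  simp [rotation, pushPull_apply, hf.pullTangent_mvfderiv]

theorem inner_rotation_normal_mvfderiv (hf : IsIsometricImmersion n f) (x : M)
    (η : normalSpace n f x) (v : TangentSpace (𝓡 n) x) :
    ⟪rotation n f T x η, mvfderiv (𝓡 n) f x v⟫_ℝ =
      -⟪(η : EuclideanSpace ℝ (Fin m)), mvfderiv (𝓡 n) T x v⟫_ℝ := by
  rw [rotation_normal, hf.inner_eq, inner_calY]

theorem inner_rotation (hf : IsIsometricImmersion n f) (hT : IsBending n f T) (x : M)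
    (u w : EuclideanSpace ℝ (Fin m)) :
    ⟪rotation n f T x u, w⟫_ℝ + ⟪u, rotation n f T x w⟫_ℝ = 0 := by
  obtain ⟨a, ξ, rfl⟩ : ∃ a, ∃ ξ : normalSpace n f x, mvfderiv (𝓡 n) f x a + ξ = u :=
    ⟨_, _, hf.mvfderiv_pullTangent_add_normalPart x u⟩
  obtain ⟨b, η, rfl⟩ : ∃ b, ∃ η : normalSpace n f x, mvfderiv (𝓡 n) f x b + η = w :=
    ⟨_, _, hf.mvfderiv_pullTangent_add_normalPart x w⟩
  have hξη : ⟪rotation n f T x ξ, (η : EuclideanSpace ℝ (Fin m))⟫_ℝ = 0 := by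
    rw [rotation_normal, real_inner_comm, inner_normal_mvfderiv]
  have hηξ : ⟪(ξ : EuclideanSpace ℝ (Fin m)), rotation n f T x η⟫_ℝ = 0 := by
    rw [rotation_normal, inner_normal_mvfderiv]
  have hξb := hf.inner_rotation_normal_mvfderiv (T := T) x ξ b
  have hηa := hf.inner_rotation_normal_mvfderiv (T := T) x η a
  rw [real_inner_comm, real_inner_comm _ (η : EuclideanSpace ℝ (Fin m))] at hηa
  simp only [map_add, hf.rotation_mvfderiv, inner_add_left, inner_add_right]
  linarith [hT.skew x a b]

variable [IsManifold (𝓡 n) ∞ M]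

theorem contMDiff_rotation (hf : IsIsometricImmersion n f)
    (hT : ContMDiff (𝓡 n) 𝓘(ℝ, EuclideanSpace ℝ (Fin m)) ∞ T) :
    ContMDiff (𝓡 n) 𝓘(ℝ, EuclideanSpace ℝ (Fin m) →L[ℝ] EuclideanSpace ℝ (Fin m)) ∞
      (rotation n f T) :=
  (hf.contMDiff_pushPull hT).sub ((contDiff_adjoint.contMDiff.comp
    (hf.contMDiff_pushPull hT)).clm_comp (contMDiff_const.sub (hf.contMDiff_pushPull hf.smooth)))

theorem mdifferentiableAt_rotation (hf : IsIsometricImmersion n f)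
    (hT : ContMDiff (𝓡 n) 𝓘(ℝ, EuclideanSpace ℝ (Fin m)) ∞ T) (x : M) :
    MDifferentiableAt (𝓡 n) 𝓘(ℝ, EuclideanSpace ℝ (Fin m) →L[ℝ] EuclideanSpace ℝ (Fin m))
      (rotation n f T) x :=
  (hf.contMDiff_rotation hT x).mdifferentiableAt (by simp)

variable {x : M}

theorem inner_mvfderiv_rotation (hf : IsIsometricImmersion n f) (hT : IsBending n f T)
    (v : TangentSpace (𝓡 n) x) (u w : EuclideanSpace ℝ (Fin m)) :
    ⟪mvfderiv (𝓡 n) (rotation n f T) x v u, w⟫_ℝ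
      + ⟪u, mvfderiv (𝓡 n) (rotation n f T) x v w⟫_ℝ = 0 := by
  have hJ := hf.mdifferentiableAt_rotation hT.smooth x
  have hderiv (u w : EuclideanSpace ℝ (Fin m)) :
      mvfderiv (𝓡 n) (fun y => ⟪rotation n f T y u, w⟫_ℝ) x v =
        ⟪mvfderiv (𝓡 n) (rotation n f T) x v u, w⟫_ℝ := by
    rw [mvfderiv_inner (hJ.clm_apply mdifferentiableAt_const) mdifferentiableAt_const,
      mvfderiv_clm_apply hJ mdifferentiableAt_const]
    simp [mvfderiv_const]
  have hskew : (fun y => ⟪rotation n f T y u, w⟫_ℝ) = -fun y => ⟪rotation n f T y w, u⟫_ℝ := by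
    funext y
    rw [Pi.neg_apply, real_inner_comm u]
    exact eq_neg_of_add_eq_zero_left (hf.inner_rotation hT y u w)
  rw [← hderiv, hskew, mvfderiv_neg, _root_.neg_apply, hderiv, real_inner_comm, neg_add_cancel]

theorem hessBending_eq (hf : IsIsometricImmersion n f) (hT : IsBending n f T)
    (v w : TangentSpace (𝓡 n) x) :
    hessBending T x v w = mvfderiv (𝓡 n) (rotation n f T) x v (mvfderiv (𝓡 n) f x w)
      + mvfderiv (𝓡 n) f x (calY f T x (sff f x v w)) := by
  have hw := mdifferentiableAt_extend (𝓡 n) (EuclideanSpace ℝ (Fin n)) w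
  have hLeibniz := mvfderiv_clm_apply (hf.mdifferentiableAt_rotation hT.smooth x)
    (mdifferentiableAt_mvfderiv_apply (hf.smooth.of_le ENat.LEInfty.out) hw) v
  simp only [hf.rotation_mvfderiv] at hLeibniz
  rw [hessBending, hLeibniz, hf.mvfderiv_mvfderiv_eq v hw, map_add, hf.rotation_mvfderiv,
    rotation_normal, extend_apply_self]
  abel

theorem hessBending_symm (hf : IsIsometricImmersion n f) (hT : IsBending n f T)
    (v w : TangentSpace (𝓡 n) x) : hessBending T x v w = hessBending T x w v := by
  have h := hf.hessian_symm (hT.smooth.of_le ENat.LEInfty.out)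
    (mdifferentiableAt_extend (𝓡 n) (EuclideanSpace ℝ (Fin n)) v)
    (mdifferentiableAt_extend (𝓡 n) (EuclideanSpace ℝ (Fin n)) w)
  rwa [extend_apply_self, extend_apply_self] at h

theorem inner_mvfderiv_rotation_mvfderiv (hf : IsIsometricImmersion n f) (hT : IsBending n f T)
    (v w z : TangentSpace (𝓡 n) x) :
    ⟪mvfderiv (𝓡 n) (rotation n f T) x v (mvfderiv (𝓡 n) f x w), mvfderiv (𝓡 n) f x z⟫_ℝ = 0 := by
  -- A trilinear form that is symmetric in its first two and alternating in its last two arguments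
  -- vanishes.
  let C (v w z : TangentSpace (𝓡 n) x) : ℝ :=
    ⟪mvfderiv (𝓡 n) (rotation n f T) x v (mvfderiv (𝓡 n) f x w), mvfderiv (𝓡 n) f x z⟫_ℝ
  have hsymm (v w z) : C v w z = C w v z := by
    have h := hf.hessBending_symm hT v w
    rw [hf.hessBending_eq hT, hf.hessBending_eq hT, hf.sff_symm x w v] at h
    simp only [C, add_right_cancel h]
  have halt (v w z) : C v w z = -C v z w := by
    refine eq_neg_of_add_eq_zero_left (Eq.trans ?_ (hf.inner_mvfderiv_rotation hT v
      (mvfderiv (𝓡 n) f x w) (mvfderiv (𝓡 n) f x z)))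
    rw [real_inner_comm _ (mvfderiv (𝓡 n) f x w)]
  change C v w z = 0
  linarith [hsymm v w z, halt w v z, hsymm w z v, halt z w v, hsymm z v w, halt v z w]

theorem beta_eq (hf : IsIsometricImmersion n f) (hT : IsBending n f T)
    (v w : TangentSpace (𝓡 n) x) :
    beta n f T x v w =
      normalPart n f x (mvfderiv (𝓡 n) (rotation n f T) x v (mvfderiv (𝓡 n) f x w)) := by
  rw [beta, hf.hessBending_eq hT, (isLinearMap_normalPart x).map_add, normalPart_mvfderiv,
    add_zero]

theorem mvfderiv_rotation_mvfderiv (hf : IsIsometricImmersion n f) (hT : IsBending n f T)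
    (v w : TangentSpace (𝓡 n) x) :
    mvfderiv (𝓡 n) (rotation n f T) x v (mvfderiv (𝓡 n) f x w) = beta n f T x v w := by
  have htangent : pullTangent n f x
      (mvfderiv (𝓡 n) (rotation n f T) x v (mvfderiv (𝓡 n) f x w)) = 0 :=
    ext_inner_right ℝ fun z => by
      rw [inner_pullTangent, hf.inner_mvfderiv_rotation_mvfderiv hT, inner_zero_left]
  have h := hf.mvfderiv_pullTangent_add_normalPart x
    (mvfderiv (𝓡 n) (rotation n f T) x v (mvfderiv (𝓡 n) f x w))
  rwa [htangent, map_zero, zero_add, ← hf.beta_eq hT, eq_comm] at h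

theorem calE_eq (hf : IsIsometricImmersion n f) (hT : IsBending n f T)
    (v : TangentSpace (𝓡 n) x) (ξ : normalSpace n f x) :
    calE n f T x v ξ = normalPart n f x (mvfderiv (𝓡 n) (rotation n f T) x v ξ) := by
  obtain ⟨η, hη, rfl⟩ := hf.exists_isSmoothNormal ξ
  have hcalY : IsSmoothField fun y => calY f T y (η y) := by
    have h := hf.isSmoothField_pullTangent ((hf.contMDiff_rotation hT.smooth).clm_apply hη)
    simpa only [rotation_normal, hf.pullTangent_mvfderiv] using h
  have hLeibniz := mvfderiv_clm_apply (hf.mdifferentiableAt_rotation hT.smooth x)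
    (hη.mdifferentiableAt x) v
  simp only [rotation_normal] at hLeibniz
  rw [hf.mvfderiv_mvfderiv_eq v (hcalY.mdifferentiableAt x), hf.mvfderiv_normal_eq v hη, map_add,
    map_neg, hf.rotation_mvfderiv, rotation_normal] at hLeibniz
  have hnormal := congrArg (normalPart n f x) hLeibniz
  simp only [(isLinearMap_normalPart x).map_add, (isLinearMap_normalPart x).map_neg,
    normalPart_mvfderiv, normalPart_normal, zero_add, add_zero] at hnormal
  rw [calE, hnormal, neg_add_cancel_right]

theorem mvfderiv_rotation_normal (hf : IsIsometricImmersion n f) (hT : IsBending n f T)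
    (v : TangentSpace (𝓡 n) x) (ξ : normalSpace n f x) :
    mvfderiv (𝓡 n) (rotation n f T) x v ξ =
      -mvfderiv (𝓡 n) f x (shape (beta n f T) x ξ v) + calE n f T x v ξ := by
  have htangent : shape (beta n f T) x ξ v =
      -pullTangent n f x (mvfderiv (𝓡 n) (rotation n f T) x v ξ) := by
    refine riesz_eq fun w => ?_
    have h := hf.inner_mvfderiv_rotation hT v ξ (mvfderiv (𝓡 n) f x w)
    rw [hf.mvfderiv_rotation_mvfderiv hT, real_inner_comm _ (ξ : EuclideanSpace ℝ (Fin m))] at h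
    rw [inner_neg_left, inner_pullTangent, Submodule.coe_inner]
    exact (eq_neg_of_add_eq_zero_right h).symm
  rw [htangent, map_neg, neg_neg, hf.calE_eq hT, hf.mvfderiv_pullTangent_add_normalPart]

theorem isCompatiblePair (hf : IsIsometricImmersion n f) (hT : IsBending n f T) :
    IsCompatiblePair (beta n f T) (calE n f T) where
  bilin_b x := (funext₂ fun v w => hf.beta_eq hT v w).symm ▸
    isBilinearMap_normalPart x (mvfderiv (𝓡 n) (rotation n f T) x) (mvfderiv (𝓡 n) f x).toLinearMap
  bilin_e x := (funext₂ fun v ξ => hf.calE_eq hT v ξ).symm ▸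
    isBilinearMap_normalPart x (mvfderiv (𝓡 n) (rotation n f T) x) (normalSpace n f x).subtype
  smooth_b X Y hX hY := by
    simp only [hf.beta_eq hT]
    exact hf.isSmoothNormal_normalPart ((contMDiff_mvfderiv_apply
      (hf.contMDiff_rotation hT.smooth) le_rfl hX).clm_apply
        (contMDiff_mvfderiv_apply hf.smooth le_rfl hY))
  smooth_e X η hX hη := by
    simp only [hf.calE_eq hT]
    exact hf.isSmoothNormal_normalPart ((contMDiff_mvfderiv_apply
      (hf.contMDiff_rotation hT.smooth) le_rfl hX).clm_apply hη)
  symm x v w := by rw [beta, beta, hf.hessBending_symm hT]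
  anti x v η ξ := by
    rw [hf.calE_eq hT, hf.calE_eq hT, inner_normalPart, inner_normalPart,
      real_inner_comm (η : EuclideanSpace ℝ (Fin m)), hf.inner_mvfderiv_rotation hT]

end IsIsometricImmersion

end Rotation

section CompatiblePair

variable {n m : ℕ} {M : Type*} [TopologicalSpace M] [ChartedSpace (EuclideanSpace ℝ (Fin n)) M]
  [RiemannianBundle (fun x : M => TangentSpace (𝓡 n) x)] [IsManifold (𝓡 n) ∞ M]
  {f : M → EuclideanSpace ℝ (Fin m)}
  {b : ∀ x : M, TangentSpace (𝓡 n) x → TangentSpace (𝓡 n) x → normalSpace n f x}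
  {e : ∀ x : M, TangentSpace (𝓡 n) x → normalSpace n f x → normalSpace n f x}
  {X Y Z : ∀ x : M, TangentSpace (𝓡 n) x} {η : ∀ x, normalSpace n f x}

namespace IsCompatiblePair

theorem isSmoothField_shape (hb : IsCompatiblePair b e) (hf : IsIsometricImmersion n f)
    (hY : IsSmoothField Y) (hη : IsSmoothNormal n f η) :
    IsSmoothField fun x => shape b x (η x) (Y x) := by
  let o := stdOrthonormalBasis ℝ (EuclideanSpace ℝ (Fin m))
  have hshape (y : M) : shape b y (η y) (Y y) =
      pullTangent n f y (∑ i, ⟪(b y (Y y) (pullTangent n f y (o i)) : EuclideanSpace ℝ (Fin m)),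
        (η y : EuclideanSpace ℝ (Fin m))⟫_ℝ • o i) := by
    rw [← hf.pullTangent_mvfderiv y (shape b y (η y) (Y y)),
      ← o.sum_repr' (mvfderiv (𝓡 n) f y (shape b y (η y) (Y y)))]
    refine congrArg _ (Finset.sum_congr rfl fun i _ => ?_)
    rw [← inner_pullTangent, real_inner_comm, inner_shape (hb.bilin_b y), Submodule.coe_inner]
  simp only [hshape]
  refine hf.isSmoothField_pullTangent (contMDiff_finsetSum fun i _ => ?_)
  have hb_basis := hb.smooth_b Y _ hY (hf.isSmoothField_pullTangent (contMDiff_const (c := o i)))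
  have hcoeff : ContMDiff (𝓡 n) 𝓘(ℝ, ℝ) ∞ fun y =>
      ⟪(b y (Y y) (pullTangent n f y (o i)) : EuclideanSpace ℝ (Fin m)),
        (η y : EuclideanSpace ℝ (Fin m))⟫_ℝ :=
    contDiff_inner.contMDiff.comp (hb_basis.prodMk_space hη)
  exact hcoeff.smul contMDiff_const

theorem inner_covB (hb : IsCompatiblePair b e) (hf : IsIsometricImmersion n f)
    (hY : IsSmoothField Y) (hZ : IsSmoothField Z) (hη : IsSmoothNormal n f η) (x : M) :
    ⟪covB b X Y Z x, η x⟫_ℝ =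
      ⟪covShape b X Y η x - shape b x (normalConn f (X x) η) (Y x), Z x⟫_ℝ := by
  have hnormal := mvfderiv_inner_normal (hb.smooth_b Y Z hY hZ) hη (X x)
  have htangent := hf.mvfderiv_inner_field
    ((hb.isSmoothField_shape hf hY hη).mdifferentiableAt x) (hZ.mdifferentiableAt x) (X x)
  simp only [inner_shape (hb.bilin_b _)] at htangent
  rw [covB, covShape]
  simp only [inner_sub_left, inner_shape (hb.bilin_b _)]
  linarith

theorem inner_codazzi (hb : IsCompatiblePair b e) (hf : IsIsometricImmersion n f)
    (hX : IsSmoothField X) (hY : IsSmoothField Y) (hZ : IsSmoothField Z)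
    (hη : IsSmoothNormal n f η) (x : M) :
    ⟪covB b X Y Z x - covB b Y X Z x
      - (e x (Y x) (sff f x (X x) (Z x)) - e x (X x) (sff f x (Y x) (Z x))), η x⟫_ℝ =
    ⟪covShape b X Y η x - covShape b Y X η x
        - shape b x (normalConn f (X x) η) (Y x) + shape b x (normalConn f (Y x) η) (X x)
      - (shape (sff f) x (e x (X x) (η x)) (Y x) - shape (sff f) x (e x (Y x) (η x)) (X x)),
      Z x⟫_ℝ := by
  have hXY := hb.inner_covB hf (X := X) hY hZ hη x
  have hYX := hb.inner_covB hf (X := Y) hX hZ hη x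
  have hantiY := hb.anti x (Y x) (sff f x (X x) (Z x)) (η x)
  have hantiX := hb.anti x (X x) (sff f x (Y x) (Z x)) (η x)
  rw [real_inner_comm (sff f x (X x) (Z x))] at hantiY
  rw [real_inner_comm (sff f x (Y x) (Z x))] at hantiX
  simp only [inner_sub_left, inner_add_left, inner_shape (hf.isBilinearMap_sff x)] at hXY hYX ⊢
  linarith

theorem codazziEq_iff (hb : IsCompatiblePair b e) (hf : IsIsometricImmersion n f) :
    CodazziEq b e ↔ CodazziShapeEq b e := by
  constructor
  · intro h X Y η hX hY hη x
    refine sub_eq_zero.1 (ext_inner_right ℝ fun z => ?_)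
    obtain ⟨Z, hZ, rfl⟩ := hf.exists_isSmoothField z
    rw [← hb.inner_codazzi hf hX hY hZ hη, sub_eq_zero.2 (h X Y Z hX hY hZ x), inner_zero_left,
      inner_zero_left]
  · intro h X Y Z hX hY hZ x
    refine sub_eq_zero.1 (ext_inner_right ℝ fun ξ => ?_)
    obtain ⟨η, hη, rfl⟩ := hf.exists_isSmoothNormal ξ
    rw [hb.inner_codazzi hf hX hY hZ hη, sub_eq_zero.2 (h X Y η hX hY hη x), inner_zero_left,
      inner_zero_left]

end IsCompatiblePair

end CompatiblePair

section Equations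

variable {n m : ℕ} {M : Type*} [TopologicalSpace M] [ChartedSpace (EuclideanSpace ℝ (Fin n)) M]
  [RiemannianBundle (fun x : M => TangentSpace (𝓡 n) x)] [IsManifold (𝓡 n) ∞ M]
  {f T : M → EuclideanSpace ℝ (Fin m)} {X Y Z : ∀ x : M, TangentSpace (𝓡 n) x}

namespace IsIsometricImmersion

theorem hessian_rotation_mvfderiv (hf : IsIsometricImmersion n f) (hT : IsBending n f T)
    (hY : IsSmoothField Y) (hZ : IsSmoothField Z) (x : M) :
    hessian (rotation n f T) (X x) Y (mvfderiv (𝓡 n) f x (Z x)) =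
      mvfderiv (𝓡 n) f x (shape (beta n f T) x (sff f x (X x) (Z x)) (Y x)
          - shape (sff f) x (beta n f T x (Y x) (Z x)) (X x))
        + (covB (beta n f T) X Y Z x - calE n f T x (Y x) (sff f x (X x) (Z x)) :
            normalSpace n f x) := by
  have hdJ := mdifferentiableAt_mvfderiv_apply
    ((hf.contMDiff_rotation hT.smooth).of_le ENat.LEInfty.out) (hY.mdifferentiableAt x)
  have hLeibniz := mvfderiv_clm_apply hdJ (mdifferentiableAt_mvfderiv_apply
    (hf.smooth.of_le ENat.LEInfty.out) (hZ.mdifferentiableAt x)) (X x)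
  simp only [hf.mvfderiv_rotation_mvfderiv hT] at hLeibniz
  rw [hf.mvfderiv_normal_eq (X x) ((hf.isCompatiblePair hT).smooth_b Y Z hY hZ),
    hf.mvfderiv_mvfderiv_eq _ (hZ.mdifferentiableAt x), map_add, hf.mvfderiv_rotation_mvfderiv hT,
    hf.mvfderiv_rotation_normal hT] at hLeibniz
  rw [hessian, _root_.sub_apply, eq_sub_of_add_eq hLeibniz.symm, hf.mvfderiv_rotation_mvfderiv hT]
  simp only [covB, map_sub, Submodule.coe_sub]
  abel

theorem gaussEq (hf : IsIsometricImmersion n f) (hT : IsBending n f T) :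
    GaussEq (beta n f T) := by
  intro X Y Z hX hY hZ x
  have hsymm := hf.hessian_symm ((hf.contMDiff_rotation hT.smooth).of_le ENat.LEInfty.out)
    (hX.mdifferentiableAt x) (hY.mdifferentiableAt x)
  have htangent := congrArg (fun A => pullTangent n f x (A (mvfderiv (𝓡 n) f x (Z x)))) hsymm
  simp only [hf.hessian_rotation_mvfderiv hT hX hZ, hf.hessian_rotation_mvfderiv hT hY hZ, map_add,
    hf.pullTangent_mvfderiv, pullTangent_normal, add_zero] at htangent
  rw [add_comm, eq_comm, add_comm]
  exact sub_eq_sub_iff_add_eq_add.1 htangent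

theorem codazziEq (hf : IsIsometricImmersion n f) (hT : IsBending n f T) :
    CodazziEq (beta n f T) (calE n f T) := by
  intro X Y Z hX hY hZ x
  have hsymm := hf.hessian_symm ((hf.contMDiff_rotation hT.smooth).of_le ENat.LEInfty.out)
    (hX.mdifferentiableAt x) (hY.mdifferentiableAt x)
  have hnormal := congrArg (fun A => normalPart n f x (A (mvfderiv (𝓡 n) f x (Z x)))) hsymm
  simp only [hf.hessian_rotation_mvfderiv hT hX hZ, hf.hessian_rotation_mvfderiv hT hY hZ,
    (isLinearMap_normalPart x).map_add, normalPart_mvfderiv, normalPart_normal, zero_add]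
    at hnormal
  exact sub_eq_sub_iff_sub_eq_sub.1 hnormal

theorem normalPart_hessian_rotation (hf : IsIsometricImmersion n f) (hT : IsBending n f T)
    {η : ∀ x, normalSpace n f x} (hY : IsSmoothField Y) (hη : IsSmoothNormal n f η) (x : M) :
    normalPart n f x (hessian (rotation n f T) (X x) Y (η x)) =
      covE (calE n f T) X Y η x - sff f x (X x) (shape (beta n f T) x (η x) (Y x))
        + beta n f T x (Y x) (shape (sff f) x (η x) (X x)) := by
  have hdJ := mdifferentiableAt_mvfderiv_apply
    ((hf.contMDiff_rotation hT.smooth).of_le ENat.LEInfty.out) (hY.mdifferentiableAt x)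
  have hE := (hf.isCompatiblePair hT).smooth_e Y η hY hη
  have hB := ((hf.isCompatiblePair hT).isSmoothField_shape hf hY hη).mdifferentiableAt x
  have hfB : MDifferentiableAt (𝓡 n) 𝓘(ℝ, EuclideanSpace ℝ (Fin m))
      (fun y => -mvfderiv (𝓡 n) f y (shape (beta n f T) y (η y) (Y y))) x :=
    (mdifferentiableAt_mvfderiv_apply (hf.smooth.of_le ENat.LEInfty.out) hB).neg
  have hLeibniz := mvfderiv_clm_apply hdJ (hη.mdifferentiableAt x) (X x)
  simp only [hf.mvfderiv_rotation_normal hT] at hLeibniz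
  rw [mvfderiv_fun_add hfB (hE.mdifferentiableAt x), mvfderiv_fun_neg, _root_.add_apply,
    _root_.neg_apply, hf.mvfderiv_mvfderiv_eq _ hB, hf.mvfderiv_normal_eq (X x) hE,
    hf.mvfderiv_normal_eq (X x) hη, map_add, map_neg, hf.mvfderiv_rotation_mvfderiv hT,
    hf.mvfderiv_rotation_normal hT] at hLeibniz
  have hnormal := congrArg (normalPart n f x) (eq_sub_of_add_eq hLeibniz.symm)
  simp only [(isLinearMap_normalPart x).map_add, (isLinearMap_normalPart x).map_sub,
    (isLinearMap_normalPart x).map_neg, normalPart_mvfderiv, normalPart_normal] at hnormal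
  rw [hessian, _root_.sub_apply, (isLinearMap_normalPart x).map_sub, hnormal, ← hf.calE_eq hT,
    covE]
  abel

theorem ricciEq (hf : IsIsometricImmersion n f) (hT : IsBending n f T) :
    RicciEq (beta n f T) (calE n f T) := by
  intro X Y η hX hY hη x
  have hsymm := hf.hessian_symm ((hf.contMDiff_rotation hT.smooth).of_le ENat.LEInfty.out)
    (hX.mdifferentiableAt x) (hY.mdifferentiableAt x)
  have hnormal := congrArg (fun A => normalPart n f x (A (η x))) hsymm
  simp only [hf.normalPart_hessian_rotation hT hX hη, hf.normalPart_hessian_rotation hT hY hη]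
    at hnormal
  rw [(hf.isCompatiblePair hT).symm x _ (Y x), hf.sff_symm x _ (Y x), ← sub_eq_zero,
    ← sub_eq_zero.2 hnormal]
  abel

end IsIsometricImmersion

end Equations

end InfinitesimalBending

end

theorem mainTheorem2 {n m : ℕ} {M : Type*} [TopologicalSpace M]
    [ChartedSpace (EuclideanSpace ℝ (Fin n)) M] [IsManifold (𝓡 n) ∞ M]
    [RiemannianBundle (fun x : M => TangentSpace (𝓡 n) x)]
    [IsContMDiffRiemannianBundle (𝓡 n) ∞ (EuclideanSpace ℝ (Fin n))
      (fun x : M => TangentSpace (𝓡 n) x)]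
    (f T : M → EuclideanSpace ℝ (Fin m))
    (hf : IsIsometricImmersion n f)
    (hT : IsBending n f T) :
    IsCompatiblePair
        (beta n f T) (calE n f T) ∧
      GaussEq (beta n f T) ∧
      CodazziEq
        (beta n f T) (calE n f T) ∧
      RicciEq
        (beta n f T) (calE n f T) ∧
      (CodazziEq
          (beta n f T) (calE n f T) ↔
        CodazziShapeEq
          (beta n f T) (calE n f T)) ∧
      ∀ (b : ∀ x : M, TangentSpace (𝓡 n) x → TangentSpace (𝓡 n) x →
            normalSpace n f x)
        (e : ∀ x : M, TangentSpace (𝓡 n) x → normalSpace n f x →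
            normalSpace n f x),
        IsCompatiblePair b e →
          (CodazziEq b e ↔ CodazziShapeEq b e) := by
  have hpair := hf.isCompatiblePair hT
  exact ⟨hpair, hf.gaussEq hT, hf.codazziEq hT, hf.ricciEq hT, hpair.codazziEq_iff hf,
    fun _ _ hbe => hbe.codazziEq_iff hf⟩
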